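/- Let $p$ be a prime, $k$ an algebraically closed field of characteristic $p$, and $E\cong(\mathbb{Z}/p)^r$ an elementary abelian $p$-group with chosen generators $g_1,\dots,g_r$ (the images of the standard generators of $(\mathbb{Z}/p)^r$ under an isomorphism). Put $X_l=g_l-1\in kE$ and $X_\alpha=\sum_l\alpha_lX_l$ for $\alpha\in k^r$. Let $\mathbb{P}^{r-1}=\operatorname{Proj}k[Y_1,\dots,Y_r]$. For a finite-dimensional $kE$-module $M$ and $n\in\mathbb{Z}$ let $\widetilde M(n)=M\otimes_k\mathcal{O}_{\mathbb{P}^{r-1}}(n)$, $\widetilde M=\widetilde M(0)$, and let $\theta_M\colon\widetilde M(n)\to\widetilde M(n+1)$ be the morphism $m\otimes f\mapsto\sum_l X_lm\otimes Y_lf$. For $1\le i\le p$ put $$\mathcal{F}_i(M)=\frac{\operatorname{Ker}\theta_M\cap\operatorname{Im}\theta_M^{i-1}}{\operatorname{Ker}\theta_M\cap\operatorname{Im}\theta_M^{i}},$$ where $\operatorname{Ker}\theta_M$ is the kernel of $\widetilde M\to\widetilde M(1)$ and $\operatorname{Im}\theta_M^{s}$ is the image of $\theta_M^s\colon\widetilde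 M(-s)\to\widetilde M$. Let $\operatorname{Rad}^j(M)=J^jM$, where $J$ is the Jacobson radical of $kE$. The module $M$ has the equal images property if the subspace $X_\alpha M$ of $M$ is the same for all non-zero $\alpha\in k^r$. Theorem. If $M$ is a finite-dimensional $kE$-module with the equal images property, then for all integers $0\le j<i\le p$ there is an isomorphism of sheaves of $\mathcal{O}_{\mathbb{P}^{r-1}}$-modules $$\mathcal{F}_i(M)\cong\mathcal{F}_{i-j}(\operatorname{Rad}^j(M)).$$ -/

import Mathlib

open CategoryTheory CategoryTheory.Limits AlgebraicGeometry TopologicalSpace Opposite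
open scoped TensorProduct

universe u v

namespace EqualImages

noncomputable section

/-! ### Projective space and the twists of `M ⊗ₖ 𝒪` -/

section Twist

/-- The standard grading of `k[Y₁, …, Yᵣ]` by degree. -/
abbrev grading (k : Type u) [Field k] (r : ℕ) : ℕ → Submodule k (MvPolynomial (Fin r) k) :=
  MvPolynomial.homogeneousSubmodule (Fin r) k

instance (k : Type u) [Field k] (r : ℕ) : GradedAlgebra (grading k r) :=
  MvPolynomial.gradedAlgebra

/-- Projective space `ℙ^{r-1} = Proj k[Y₁, …, Yᵣ]`, as a scheme. -/
abbrev projSpace (k : Type u) [Field k] (r : ℕ) : Scheme.{u} := Proj (grading k r)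

/-- The underlying topological space of `ℙ^{r-1}`, whose points are the relevant homogeneous
primes of `k[Y₁, …, Yᵣ]`. -/
abbrev projTop (k : Type u) [Field k] (r : ℕ) : TopCat.{u} := ProjectiveSpectrum.top (grading k r)

/-- The sheaf of rings of `ℙ^{r-1}`. -/
abbrev projRing (k : Type u) [Field k] (r : ℕ) : TopCat.Sheaf CommRingCat.{u} (projTop k r) :=
  ProjectiveSpectrum.Proj.structureSheaf (grading k r)

variable {k : Type u} [Field k] {r : ℕ}

/-- The homogeneous prime ideal that a point `x` of `ℙ^{r-1}` is. -/
def primeAt (x : projTop k r) : Ideal (MvPolynomial (Fin r) k) :=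
  HomogeneousIdeal.toIdeal (ProjectiveSpectrum.asHomogeneousIdeal (𝒜 := grading k r) x)

instance (x : projTop k r) : (primeAt x).IsPrime :=
  ProjectiveSpectrum.isPrime (𝒜 := grading k r) x

/-- The localization (in all degrees) of `k[Y₁, …, Yᵣ]` at the homogeneous prime `x`. -/
abbrev LocAt (x : projTop k r) : Type u := Localization.AtPrime (primeAt x)

/-- The value in `LocAt x` of a section of the structure sheaf at `x`. -/
def valAt {U : (Opens (projTop k r))ᵒᵖ} (x : U.unop) : (projRing k r).1.obj U →+* LocAt x.1 where
  toFun a := HomogeneousLocalization.val (a.1 x)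
  map_zero' := HomogeneousLocalization.val_zero
  map_one' := HomogeneousLocalization.val_one
  map_add' a b := HomogeneousLocalization.val_add (a.1 x) (b.1 x)
  map_mul' a b := HomogeneousLocalization.val_mul (a.1 x) (b.1 x)

/-- The obvious map `(k[Y₁, …, Yᵣ])_e ⊗ₖ M → k[Y₁, …, Yᵣ]_x ⊗ₖ M`. -/
def numMap (M : Type u) [AddCommGroup M] [Module k M] (e : ℕ) (x : projTop k r) :
    grading k r e ⊗[k] M →ₗ[k] LocAt x ⊗[k] M :=
  LinearMap.rTensor M
    ((IsScalarTower.toAlgHom k (MvPolynomial (Fin r) k) (LocAt x)).toLinearMap ∘ₗ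
      (grading k r e).subtype)

/-- `s` is given on all of `U` by one fraction `v / g` of degree `n`, with `g` a homogeneous
polynomial vanishing nowhere on `U`, and `v = ∑ fₐ ⊗ mₐ` where the polynomials `fₐ` are
homogeneous of degree `deg g + n`. -/
def IsTwistFraction (M : Type u) [AddCommGroup M] [Module k M] (n : ℤ)
    {U : Opens (projTop k r)} (s : ∀ x : U, LocAt x.1 ⊗[k] M) : Prop :=
  ∃ (d e : ℕ) (_ : (e : ℤ) = d + n) (g : grading k r d) (v : grading k r e ⊗[k] M),
    ∀ x : U, g.1 ∉ primeAt x.1 ∧ g.1 • s x = numMap M e x.1 v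

/-- `IsTwistFraction` is stable under restriction to smaller open sets. -/
def isTwistFractionPrelocal (M : Type u) [AddCommGroup M] [Module k M] (n : ℤ) :
    TopCat.PrelocalPredicate (fun x : projTop k r => LocAt x ⊗[k] M) where
  pred s := IsTwistFraction M n s
  res := by
    rintro V U i s ⟨d, e, h, g, v, w⟩
    exact ⟨d, e, h, g, v, fun x => w (i x)⟩

/-- The sections of `M ⊗ₖ 𝒪(n)` are the functions that are locally fractions of degree `n`. -/
def isLocallyTwistFraction (M : Type u) [AddCommGroup M] [Module k M] (n : ℤ) :
    TopCat.LocalPredicate (fun x : projTop k r => LocAt x ⊗[k] M) :=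
  (isTwistFractionPrelocal M n).sheafify

variable (M : Type u) [AddCommGroup M] [Module k M]

lemma exists_mul_numMap {c d e : ℕ} (hc : c = d + e) (g : grading k r d)
    (v : grading k r e ⊗[k] M) :
    ∃ w : grading k r c ⊗[k] M, ∀ x, numMap M c x w = g.1 • numMap M e x v := by
  subst hc
  induction v with
  | zero => exact ⟨0, fun x => by simp⟩
  | add v v' hv hv' =>
    obtain ⟨w, hw⟩ := hv
    obtain ⟨w', hw'⟩ := hv'
    exact ⟨w + w', fun x => by simp only [map_add, hw, hw', smul_add]⟩
  | tmul f m =>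
    refine ⟨⟨g.1 * f.1, SetLike.mul_mem_graded g.2 f.2⟩ ⊗ₜ m, fun x => ?_⟩
    simp [numMap, TensorProduct.smul_tmul', Algebra.smul_def]

lemma exists_X_notMem (x : projTop k r) :
    ∃ i, (MvPolynomial.X i : MvPolynomial (Fin r) k) ∉ primeAt x := by
  by_contra! h
  apply ProjectiveSpectrum.not_irrelevant_le (𝒜 := grading k r) x
  intro f hf
  have hf0 : f ∈ Ideal.span (MvPolynomial.X '' (Set.univ : Set (Fin r))) := by
    rw [MvPolynomial.mem_ideal_span_X_image]
    intro m hm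
    by_contra! h0
    have : m = 0 := Finsupp.ext fun i => h0 i trivial
    subst this
    rw [HomogeneousIdeal.mem_irrelevant_iff] at hf
    have h1 : MvPolynomial.homogeneousComponent 0 f = 0 := by
      rw [← hf, GradedRing.proj_apply]
      exact (MvPolynomial.decomposition.decompose'_apply f 0).symm
    rw [MvPolynomial.homogeneousComponent_zero, MvPolynomial.C_eq_zero] at h1
    exact MvPolynomial.mem_support_iff.mp hm h1
  refine (Ideal.span_le.mpr ?_ : _ ≤ primeAt x) hf0
  rintro _ ⟨i, -, rfl⟩
  exact h i

/-- The sections of `M ⊗ₖ 𝒪(n)` over `U`. -/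
def twistSections (n : ℤ) (U : (Opens (projTop k r))ᵒᵖ) :
    AddSubgroup (∀ x : U.unop, LocAt x.1 ⊗[k] M) where
  carrier := {s | (isLocallyTwistFraction M n).pred s}
  zero_mem' := by
    intro x
    obtain ⟨i, hi⟩ := exists_X_notMem x.1
    let g : grading k r (-n).toNat :=
      ⟨MvPolynomial.X i ^ (-n).toNat, by
        simpa using (MvPolynomial.isHomogeneous_X k i).pow (-n).toNat⟩
    refine ⟨U.unop ⊓ ProjectiveSpectrum.basicOpen (grading k r) g.1,
      ⟨x.2, fun h => hi (Ideal.IsPrime.mem_of_pow_mem inferInstance _ h)⟩,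
      Opens.infLELeft _ _, (-n).toNat, n.toNat, by omega, g, 0, fun y => ⟨y.2.2, ?_⟩⟩
    rw [map_zero]
    exact smul_zero _
  add_mem' := by
    intro a b ha hb x
    obtain ⟨V, hV, i, d, e, h, g, v, w⟩ := ha x
    obtain ⟨V', hV', i', d', e', h', g', v', w'⟩ := hb x
    obtain ⟨z, hz⟩ := exists_mul_numMap M (c := d' + e) rfl g' v
    obtain ⟨z', hz'⟩ := exists_mul_numMap M (c := d' + e) (by omega) g v'
    refine ⟨V ⊓ V', ⟨hV, hV'⟩, Opens.infLELeft _ _ ≫ i, d' + d, d' + e, by push_cast; omega,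
      ⟨g'.1 * g.1, SetLike.mul_mem_graded g'.2 g.2⟩, z + z', fun y => ?_⟩
    have h1 := w ⟨y.1, y.2.1⟩
    have h2 := w' ⟨y.1, y.2.2⟩
    refine ⟨(primeAt y.1).primeCompl.mul_mem h2.1 h1.1, ?_⟩
    rw [map_add, hz, hz', ← h1.2, ← h2.2, ← mul_smul, ← mul_smul, mul_comm g.1, ← smul_add]
    rfl
  neg_mem' := by
    intro a ha x
    obtain ⟨V, hV, i, d, e, h, g, v, w⟩ := ha x
    refine ⟨V, hV, i, d, e, h, g, (-1 : k) • v, fun y => ⟨(w y).1, ?_⟩⟩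
    rw [map_smul, ← (w y).2]
    exact (smul_neg g.1 (a (i y))).trans (neg_one_smul k (g.1 • a (i y))).symm

lemma smul_mem_twistSections (n : ℤ) (U : (Opens (projTop k r))ᵒᵖ) (a : (projRing k r).1.obj U)
    (s : twistSections M n U) :
    (fun x : U.unop => valAt x a • s.1 x) ∈ twistSections M n U := by
  intro x
  obtain ⟨V, hV, i, d, e, h, g, v, w⟩ := s.2 x
  obtain ⟨V', hV', i', c, p, q, hq, hp⟩ := a.2 x
  obtain ⟨z, hz⟩ := exists_mul_numMap M (c := c + e) rfl p v
  refine ⟨V ⊓ V', ⟨hV, hV'⟩, Opens.infLELeft _ _ ≫ i, c + d, c + e, by push_cast; omega,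
      ⟨q.1 * g.1, SetLike.mul_mem_graded q.2 g.2⟩, z, fun y => ?_⟩
  have h1 := w ⟨y.1, y.2.1⟩
  have hq' : q.1 ∈ (primeAt y.1).primeCompl := hq ⟨y.1, y.2.2⟩
  have h2 : valAt (i' ⟨y.1, y.2.2⟩) a = Localization.mk p.1 ⟨q.1, hq'⟩ :=
    congrArg HomogeneousLocalization.val (hp ⟨y.1, y.2.2⟩)
  have h3 : q.1 • (Localization.mk p.1 ⟨q.1, hq'⟩ : LocAt y.1) = algebraMap _ _ p.1 := by
    rw [Localization.mk_eq_mk', Algebra.smul_def]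
    exact IsLocalization.mk'_spec' (LocAt y.1) p.1 (⟨q.1, hq'⟩ : (primeAt y.1).primeCompl)
  refine ⟨(primeAt y.1).primeCompl.mul_mem hq' h1.1, ?_⟩
  rw [hz, ← h1.2]
  change (q.1 * g.1) • valAt (i' ⟨y.1, y.2.2⟩) a • s.1 (i ⟨y.1, y.2.1⟩) =
    p.1 • g.1 • s.1 (i ⟨y.1, y.2.1⟩)
  rw [h2, mul_smul, smul_comm g.1, ← smul_assoc]
  refine (congrArg (· • _) h3).trans ?_
  exact algebraMap_smul _ _ _

instance twistModule (n : ℤ) (U : (Opens (projTop k r))ᵒᵖ) :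
    Module ((projRing k r).1.obj U) (twistSections M n U) where
  smul a s := ⟨_, smul_mem_twistSections M n U a s⟩
  one_smul s := Subtype.ext (funext fun x => by
    change valAt x 1 • s.1 x = s.1 x
    rw [map_one, one_smul])
  mul_smul a b s := Subtype.ext (funext fun x => by
    change valAt x (a * b) • s.1 x = valAt x a • valAt x b • s.1 x
    rw [map_mul, mul_smul])
  smul_zero a := Subtype.ext (funext fun x => smul_zero (valAt x a))
  smul_add a s t := Subtype.ext (funext fun x => smul_add (valAt x a) (s.1 x) (t.1 x))
  add_smul a b s := Subtype.ext (funext fun x => by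
    change valAt x (a + b) • s.1 x = valAt x a • s.1 x + valAt x b • s.1 x
    rw [map_add, add_smul])
  zero_smul s := Subtype.ext (funext fun x => by
    change valAt x 0 • s.1 x = 0
    rw [map_zero, zero_smul])

/-- The presheaf of abelian groups underlying `M ⊗ₖ 𝒪(n)`. -/
def twistPresheaf (n : ℤ) : TopCat.Presheaf Ab.{u} (projTop k r) where
  obj U := AddCommGrpCat.of (twistSections M n U)
  map i := AddCommGrpCat.ofHom
    { toFun := fun s => ((TopCat.subsheafToTypes (isLocallyTwistFraction M n)).1.map i) s
      map_zero' := rfl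
      map_add' := fun _ _ => rfl }

lemma twistPresheaf_isSheaf (n : ℤ) : (twistPresheaf (k := k) (r := r) M n).IsSheaf :=
  (TopCat.Presheaf.isSheaf_iff_isSheaf_comp (forget Ab.{u}) _).mpr
    (TopCat.Presheaf.isSheaf_of_iso
      (NatIso.ofComponents (fun _ => Iso.refl _) (by cat_disch) :
        (TopCat.subsheafToTypes (isLocallyTwistFraction (k := k) (r := r) M n)).1 ≅
          twistPresheaf (k := k) (r := r) M n ⋙ forget Ab.{u})
      (TopCat.subsheafToTypes (isLocallyTwistFraction (k := k) (r := r) M n)).property)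

instance (n : ℤ) (U : (Opens (projSpace k r))ᵒᵖ) :
    Module ((projSpace k r).ringCatSheaf.obj.obj U) ((twistPresheaf (k := k) (r := r) M n).obj U) :=
  twistModule M n U

/-- The sheaf `M ⊗ₖ 𝒪(n)` of modules on `ℙ^{r-1}`. -/
def twist (n : ℤ) : (projSpace k r).Modules where
  val := PresheafOfModules.ofPresheaf (twistPresheaf M n) (fun _ _ _ _ _ => rfl)
  isSheaf := twistPresheaf_isSheaf M n

end Twist

/-! ### The operator `θ` -/

section Theta

variable {k : Type u} [Field k] {r : ℕ} {M : Type u} [AddCommGroup M] [Module k M]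

/-- The operator `f ⊗ m ↦ ∑ᵢ Yᵢ f ⊗ Xᵢ m` on `k[Y₁, …, Yᵣ]_x ⊗ₖ M`. -/
def thetaAt (X : Fin r → Module.End k M) (x : projTop k r) :
    LocAt x ⊗[k] M →ₗ[LocAt x] LocAt x ⊗[k] M :=
  ∑ i, algebraMap (MvPolynomial (Fin r) k) (LocAt x) (MvPolynomial.X i) •
    (X i).baseChange (LocAt x)

lemma thetaAt_tmul (X : Fin r → Module.End k M) (x : projTop k r) (f : LocAt x) (m : M) :
    thetaAt X x (f ⊗ₜ m) =
      ∑ i, (algebraMap (MvPolynomial (Fin r) k) (LocAt x) (MvPolynomial.X i) * f) ⊗ₜ X i m := by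
  simp [thetaAt, TensorProduct.smul_tmul', Algebra.smul_def]

lemma exists_theta_numMap (X : Fin r → Module.End k M) {c e : ℕ} (hc : c = e + 1)
    (v : grading k r e ⊗[k] M) :
    ∃ w : grading k r c ⊗[k] M, ∀ x, numMap M c x w = thetaAt X x (numMap M e x v) := by
  induction v with
  | zero => exact ⟨0, fun x => by simp⟩
  | add v v' hv hv' =>
    obtain ⟨w, hw⟩ := hv
    obtain ⟨w', hw'⟩ := hv'
    exact ⟨w + w', fun x => by simp only [map_add, hw, hw']⟩
  | tmul f m =>
    subst hc
    refine ⟨∑ i, ⟨MvPolynomial.X i * f.1, by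
      rw [add_comm e 1]
      exact SetLike.mul_mem_graded (A := grading k r) (MvPolynomial.isHomogeneous_X k i) f.2⟩ ⊗ₜ
        X i m, fun x => ?_⟩
    simp [numMap, thetaAt_tmul, map_sum]

lemma theta_mem (X : Fin r → Module.End k M) {n m : ℤ} (h : n + 1 = m)
    (U : (Opens (projTop k r))ᵒᵖ) (s : twistSections M n U) :
    (fun x : U.unop => thetaAt X x.1 (s.1 x)) ∈ twistSections M m U := by
  intro x
  obtain ⟨V, hV, i, d, e, he, g, v, w⟩ := s.2 x
  obtain ⟨z, hz⟩ := exists_theta_numMap X rfl v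
  refine ⟨V, hV, i, d, e + 1, by push_cast; omega, g, z, fun y => ⟨(w y).1, ?_⟩⟩
  rw [hz, ← (w y).2]
  exact ((thetaAt X y.1).map_smul_of_tower g.1 (s.1 (i y))).symm

/-- The operator `θ : M ⊗ₖ 𝒪(n) ⟶ M ⊗ₖ 𝒪(n + 1)`, `m ⊗ f ↦ ∑ᵢ Xᵢ m ⊗ Yᵢ f`. -/
def theta (X : Fin r → Module.End k M) {n m : ℤ} (h : n + 1 = m) :
    (twist M n : (projSpace k r).Modules) ⟶ twist M m :=
  SheafOfModules.Hom.mk (PresheafOfModules.homMk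
    { app := fun U => AddCommGrpCat.ofHom
        { toFun := fun s : twistSections M n U =>
            (⟨_, theta_mem X h U s⟩ : twistSections M m U)
          map_zero' := Subtype.ext (funext fun x => map_zero (thetaAt X x.1))
          map_add' := fun s t => Subtype.ext (funext fun x =>
            map_add (thetaAt X x.1) (s.1 x) (t.1 x)) }
      naturality := fun _ _ _ => rfl }
    (fun _ a s => Subtype.ext (funext fun x =>
      (thetaAt X x.1).map_smul (valAt x a) (s.1 x))))

/-- The iterate `θ^i : M ⊗ₖ 𝒪(n) ⟶ M ⊗ₖ 𝒪(n + i)`. -/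
def thetaPow (X : Fin r → Module.End k M) :
    (i : ℕ) → (n m : ℤ) → n + i = m → ((twist M n : (projSpace k r).Modules) ⟶ twist M m)
  | 0, n, m, h => eqToHom (congrArg (twist M) (by simpa using h))
  | i + 1, n, m, h => theta X rfl ≫ thetaPow X i (n + 1) m (by push_cast at h; omega)

/-- `Ker θ`, as a subsheaf of `M ⊗ₖ 𝒪`. -/
def kerTheta (X : Fin r → Module.End k M) :
    Subobject (twist M 0 : (projSpace k r).Modules) :=
  kernelSubobject (theta X (zero_add 1))

/-- `Im θ^i`, the image of `M ⊗ₖ 𝒪(-i) ⟶ M ⊗ₖ 𝒪`, as a subsheaf of `M ⊗ₖ 𝒪`. -/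
def imThetaPow (X : Fin r → Module.End k M) (i : ℕ) :
    Subobject (twist M 0 : (projSpace k r).Modules) :=
  imageSubobject (thetaPow X i (-i) 0 (neg_add_cancel _))

lemma imThetaPow_succ_le (X : Fin r → Module.End k M) (i : ℕ) :
    imThetaPow X (i + 1) ≤ imThetaPow X i := by
  have key : ∀ (n : ℤ) (hn : n = -i) (h : n + i = 0),
      imageSubobject (thetaPow X i n 0 h) = imThetaPow X i := by
    rintro n rfl h
    rfl
  rw [← key (-((i + 1 : ℕ) : ℤ) + 1) (by push_cast; omega) (by push_cast; omega)]
  exact imageSubobject_comp_le _ _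

lemma imThetaPow_le_pred (X : Fin r → Module.End k M) (i : ℕ) :
    imThetaPow X i ≤ imThetaPow X (i - 1) := by
  cases i with
  | zero => exact le_rfl
  | succ i => exact imThetaPow_succ_le X i

/-- The subquotient `(Ker θ ∩ Im θ^{i-1}) / (Ker θ ∩ Im θ^i)` of `M ⊗ₖ 𝒪`, for `i ≥ 1`. -/
def subquotientSheaf (X : Fin r → Module.End k M) (i : ℕ) : (projSpace k r).Modules :=
  cokernel (Subobject.ofLE (kerTheta X ⊓ imThetaPow X i) (kerTheta X ⊓ imThetaPow X (i - 1))
    (inf_le_inf_left _ (imThetaPow_le_pred X i)))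

end Theta

/-! ### Modules over the group algebra of an elementary abelian group -/

section GroupAlgebra

variable (k : Type u) [Field k] {p r : ℕ} {E : Type v} [CommGroup E]
  (e : Multiplicative (Fin r → ZMod p) ≃* E)

/-- The element `Xᵢ = gᵢ - 1` of `kE`, where `g₁, …, gᵣ` are the generators of `E` that the
isomorphism `e : (ℤ/p)^r ≃ E` chooses. -/
def xGen (i : Fin r) : MonoidAlgebra k E :=
  MonoidAlgebra.of k E (e (Multiplicative.ofAdd (Pi.single i 1))) - 1

/-- The element `X_α = ∑ᵢ αᵢ Xᵢ` of `kE`. -/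
def xAlpha (α : Fin r → k) : MonoidAlgebra k E := ∑ i, α i • xGen k e i

variable (M : Type u) [AddCommGroup M] [Module (MonoidAlgebra k E) M]

/-- The equal images property: the image of `X_α` acting on `M` is the same for all `α ≠ 0`. -/
def HasEqualImages : Prop :=
  ∀ α β : Fin r → k, α ≠ 0 → β ≠ 0 →
    Set.range (fun m : M => xAlpha k e α • m) = Set.range (fun m : M => xAlpha k e β • m)

variable (E) in
/-- The `j`-th radical `Rad^j(M) = J^j M`, where `J` is the Jacobson radical of `kE`. -/
def radPow (j : ℕ) : Submodule (MonoidAlgebra k E) M :=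
  Ring.jacobson (MonoidAlgebra k E) ^ j • ⊤

variable [Module k M] [IsScalarTower k (MonoidAlgebra k E) M]

/-- The sheaf `ℱᵢ(M)` on `ℙ^{r-1}` attached to a `kE`-module `M`. -/
def sheafF (i : ℕ) : (projSpace k r).Modules :=
  subquotientSheaf (fun l => (Algebra.lsmul k k M (xGen k e l) : Module.End k M)) i

end GroupAlgebra

end

end EqualImages

/-! The radical `J` of `kE` is generated by the `X_l`, each of which is `X_α` for a unit vector `α`.
Under equal images the common image `X_α M` therefore contains `J M`, and since `kE` is commutative,
`X_α Rad^j(M) = Rad^{j+1}(M)` for every non-zero `α` (`HasEqualImages.exists_xAlpha_smul_eq`). So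
`θ`, as a morphism from the twists of `Rad^j(M)` to those of `Rad^{j+1}(M)`, is surjective on the
fibre at each closed point of projective space, hence an epimorphism by Nakayama and the
Nullstellensatz (`epi_thetaHom`).

Composing `j` of these morphisms, `θ^j` factors as an epimorphism onto `Rad^j(M) ⊗ 𝒪` followed by
its inclusion in `M ⊗ 𝒪` (`HasEqualImages.exists_epi_comp_eq_thetaPow`). Inside `M ⊗ 𝒪`, the image
of `θ^{j+c}` is then the image of `θ^c` on `Rad^j(M) ⊗ 𝒪`, while the kernel of `θ` on the latter is
the intersection with `Ker θ_M`. The two subquotients thus agree after the index shift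
(`nonempty_subquotientSheaf_iso`). -/

namespace EqualImages

/-! ### Images, kernels and subquotients along a monomorphism -/

section Subobjects

universe w w'

/-- The identification of a subobject of `B` with its image under a monomorphism `B ⟶ A`. -/
noncomputable def mapUnderlyingIso {C : Type w} [Category.{w'} C] {A B : C} (ι : B ⟶ A) [Mono ι]
    (S : Subobject B) : (S : C) ≅ ((Subobject.map ι).obj S : C) :=
  (Subobject.underlyingIso (S.arrow ≫ ι)).symm ≪≫
    Subobject.isoOfEq _ _ ((Subobject.map_mk S.arrow ι).symm.trans (by rw [Subobject.mk_arrow]))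

@[simp]
lemma mapUnderlyingIso_hom_arrow {C : Type w} [Category.{w'} C] {A B : C} (ι : B ⟶ A) [Mono ι]
    (S : Subobject B) :
    (mapUnderlyingIso ι S).hom ≫ ((Subobject.map ι).obj S).arrow = S.arrow ≫ ι := by
  simp [mapUnderlyingIso, Subobject.isoOfEq]

variable {C : Type w} [Category.{w'} C] [Abelian C]

/-- The inclusion of the left image in the right one is monic, and epic because `q` is; an abelian
category is balanced. -/
lemma imageSubobject_epi_comp {X Y Z : C} (q : X ⟶ Y) [Epi q] (f : Y ⟶ Z) :
    imageSubobject (q ≫ f) = imageSubobject f := by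
  have : IsIso (Subobject.ofLE _ _ (imageSubobject_comp_le q f)) := isIso_of_mono_of_epi _
  exact Subobject.eq_of_comm (asIso (Subobject.ofLE _ _ (imageSubobject_comp_le q f))) (by simp)

lemma imageSubobject_comp_mono_eq_map {X Y Z : C} (f : X ⟶ Y) (ι : Y ⟶ Z) [Mono ι] :
    imageSubobject (f ≫ ι) = (Subobject.map ι).obj (imageSubobject f) := by
  conv_lhs => rw [← image.fac f, Category.assoc]
  rw [imageSubobject_epi_comp, imageSubobject_mono]
  exact (Subobject.map_mk _ _).symm

/-- Since `ι'` is monic, a morphism into `B` is killed by `g` exactly when its composite with `ι` is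
killed by `f`. -/
lemma map_kernelSubobject {A B A' B' : C} (ι : B ⟶ A) [Mono ι] (ι' : B' ⟶ A') [Mono ι']
    (f : A ⟶ A') (g : B ⟶ B') (w : g ≫ ι' = ι ≫ f) :
    (Subobject.map ι).obj (kernelSubobject g) = kernelSubobject f ⊓ Subobject.mk ι := by
  apply le_antisymm
  · refine le_inf ?_ ?_
    · refine Subobject.le_of_comm (factorThruKernelSubobject _ (Subobject.arrow _) ?_)
        (factorThruKernelSubobject_comp_arrow _ _ _)
      rw [← cancel_epi (mapUnderlyingIso ι (kernelSubobject g)).hom, ← Category.assoc,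
        mapUnderlyingIso_hom_arrow, Category.assoc, ← w, ← Category.assoc,
        kernelSubobject_arrow_comp, zero_comp, comp_zero]
    · exact Subobject.le_mk_of_comm ((mapUnderlyingIso ι (kernelSubobject g)).inv ≫
        (kernelSubobject g).arrow) (by rw [Category.assoc, Iso.inv_comp_eq, mapUnderlyingIso_hom_arrow])
  · set S := kernelSubobject f ⊓ Subobject.mk ι
    let a : (S : C) ⟶ B := Subobject.ofLE S _ inf_le_right ≫ (Subobject.underlyingIso ι).hom
    have ha : a ≫ ι = S.arrow := by simp [a]
    have hk : S.arrow ≫ f = 0 := by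
      rw [← Subobject.ofLE_arrow (inf_le_left : S ≤ kernelSubobject f), Category.assoc,
        kernelSubobject_arrow_comp, comp_zero]
    have hg : a ≫ g = 0 := by
      rw [← cancel_mono ι', Category.assoc, w, ← Category.assoc, ha, hk, zero_comp]
    refine Subobject.le_of_comm (factorThruKernelSubobject g a hg ≫
      (mapUnderlyingIso ι (kernelSubobject g)).hom) ?_
    rw [Category.assoc, mapUnderlyingIso_hom_arrow, ← Category.assoc,
      factorThruKernelSubobject_comp_arrow, ha]

/-- Quotients of subobjects do not change along a monomorphism of the ambient objects. -/
lemma nonempty_cokernel_ofLE_iso {A B : C} (ι : B ⟶ A) [Mono ι] {S T : Subobject A}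
    {S' T' : Subobject B} (h : S ≤ T) (h' : S' ≤ T') (hS : (Subobject.map ι).obj S' = S)
    (hT : (Subobject.map ι).obj T' = T) :
    Nonempty (cokernel (Subobject.ofLE S T h) ≅ cokernel (Subobject.ofLE S' T' h')) := by
  subst hS hT
  refine ⟨(cokernel.mapIso _ _ (mapUnderlyingIso ι S') (mapUnderlyingIso ι T') ?_).symm⟩
  rw [← cancel_mono (Subobject.arrow _), Category.assoc, Category.assoc, Subobject.ofLE_arrow,
    mapUnderlyingIso_hom_arrow, mapUnderlyingIso_hom_arrow, ← Category.assoc, Subobject.ofLE_arrow]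

end Subobjects

end EqualImages

namespace EqualImages

noncomputable section

/-! ### The cokernel of `θ` over the polynomial ring -/

section Polynomials

variable {k : Type u} [Field k] {r : ℕ} {M N : Type u} [AddCommGroup M] [Module k M]
  [AddCommGroup N] [Module k N]

/-- The operator `f ⊗ m ↦ ∑ᵢ Yᵢ f ⊗ Xᵢ m` on `k[Y₁, …, Yᵣ] ⊗ₖ M`. -/
def thetaPoly (X : Fin r → M →ₗ[k] N) :
    MvPolynomial (Fin r) k ⊗[k] M →ₗ[MvPolynomial (Fin r) k] MvPolynomial (Fin r) k ⊗[k] N :=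
  ∑ i, (MvPolynomial.X i : MvPolynomial (Fin r) k) • (X i).baseChange (MvPolynomial (Fin r) k)

lemma thetaPoly_tmul (X : Fin r → M →ₗ[k] N) (f : MvPolynomial (Fin r) k) (m : M) :
    thetaPoly X (f ⊗ₜ m) = ∑ i, (MvPolynomial.X i * f) ⊗ₜ X i m := by
  simp [thetaPoly, TensorProduct.smul_tmul']

/-- If all specializations of `θ` at non-zero points are surjective, then the annihilator of its
cokernel has no zeros apart from the origin. -/
lemma exists_mem_annihilator_eval_ne_zero [Module.Finite k N] (X : Fin r → M →ₗ[k] N)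
    (α : Fin r → k) (hX : Function.Surjective (∑ l, α l • X l : M →ₗ[k] N)) :
    ∃ a ∈ Module.annihilator (MvPolynomial (Fin r) k)
      ((MvPolynomial (Fin r) k ⊗[k] N) ⧸ LinearMap.range (thetaPoly X)),
      MvPolynomial.aeval α a ≠ 0 := by
  let I : Ideal (MvPolynomial (Fin r) k) :=
    RingHom.ker (MvPolynomial.aeval α : MvPolynomial (Fin r) k →ₐ[k] k)
  -- Modulo the maximal ideal `I` of the point `α`, `θ` becomes `∑ α_l X_l`, which is onto; so the
  -- cokernel equals `I` times itself.
  have hle : (⊤ : Submodule (MvPolynomial (Fin r) k)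
      ((MvPolynomial (Fin r) k ⊗[k] N) ⧸ LinearMap.range (thetaPoly X))) ≤
      I • ⊤ := by
    rintro z -
    obtain ⟨z, rfl⟩ := Submodule.mkQ_surjective _ z
    induction z with
    | zero => rw [map_zero]; exact zero_mem _
    | add z z' hz hz' => rw [map_add]; exact add_mem hz hz'
    | tmul f n =>
      obtain ⟨m, rfl⟩ := hX n
      have h0 : Submodule.mkQ (LinearMap.range (thetaPoly X)) (thetaPoly X (f ⊗ₜ m)) = 0 :=
        (Submodule.Quotient.mk_eq_zero _).mpr ⟨_, rfl⟩
      have h1 : f ⊗ₜ[k] ((∑ l, α l • X l) m) = thetaPoly X (f ⊗ₜ m) -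
          ∑ l, (MvPolynomial.X l - MvPolynomial.C (α l) : MvPolynomial (Fin r) k) • (f ⊗ₜ[k] X l m) := by
        rw [thetaPoly_tmul, ← Finset.sum_sub_distrib, LinearMap.sum_apply, TensorProduct.tmul_sum]
        refine Finset.sum_congr rfl fun l _ => ?_
        rw [TensorProduct.smul_tmul', smul_eq_mul, sub_mul, TensorProduct.sub_tmul, sub_sub_cancel,
          ← MvPolynomial.smul_eq_C_mul, TensorProduct.smul_tmul, LinearMap.smul_apply]
      rw [h1, map_sub, h0, zero_sub, map_sum]
      refine neg_mem (sum_mem fun l _ => ?_)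
      rw [map_smul]
      exact Submodule.smul_mem_smul (by simp [I]) trivial
  -- Nakayama: some `a ≡ 1` modulo `I` kills the cokernel, so `a` takes the value 1 at `α`.
  obtain ⟨a, ha, ha'⟩ := Submodule.exists_sub_one_mem_and_smul_eq_zero_of_fg_of_le_smul I ⊤
    Module.Finite.fg_top hle
  refine ⟨a, Module.mem_annihilator.mpr fun z => ha' z trivial, ?_⟩
  have : MvPolynomial.aeval α (a - 1) = 0 := ha
  rw [map_sub, map_one, sub_eq_zero] at this
  rw [this]
  exact one_ne_zero

/-- By the Nullstellensatz: the annihilator of the cokernel vanishes at most at the origin, where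
`Y_l` vanishes too, so a power of `Y_l` lies in the annihilator. -/
lemma exists_X_pow_smul_mem_range [IsAlgClosed k] [Module.Finite k N] (X : Fin r → M →ₗ[k] N)
    (hX : ∀ α : Fin r → k, α ≠ 0 → Function.Surjective (∑ l, α l • X l : M →ₗ[k] N)) (l : Fin r) :
    ∃ c : ℕ, ∀ z : MvPolynomial (Fin r) k ⊗[k] N,
      (MvPolynomial.X l ^ c : MvPolynomial (Fin r) k) • z ∈ LinearMap.range (thetaPoly X) := by
  set I := Module.annihilator (MvPolynomial (Fin r) k)
      ((MvPolynomial (Fin r) k ⊗[k] N) ⧸ LinearMap.range (thetaPoly X)) with hI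
  have h : (MvPolynomial.X l : MvPolynomial (Fin r) k) ∈ I.radical := by
    rw [← MvPolynomial.vanishingIdeal_zeroLocus_eq_radical (K := k),
      MvPolynomial.mem_vanishingIdeal_iff]
    intro α hα
    by_contra h
    rw [MvPolynomial.aeval_X] at h
    obtain ⟨a, ha, ha'⟩ := exists_mem_annihilator_eval_ne_zero X α
      (hX α fun h0 => h (by rw [h0, Pi.zero_apply]))
    exact ha' (hα a ha)
  obtain ⟨c, hc⟩ := h
  refine ⟨c, fun z => ?_⟩
  have := Module.mem_annihilator.mp hc (Submodule.Quotient.mk z)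
  rwa [← Submodule.Quotient.mk_smul, Submodule.Quotient.mk_eq_zero] at this

/-- The projection of `k[Y₁, …, Yᵣ] ⊗ₖ M` to its component of degree `e`. -/
def componentMap (r : ℕ) (M : Type u) [AddCommGroup M] [Module k M] (e : ℕ) :
    MvPolynomial (Fin r) k ⊗[k] M →ₗ[k] grading k r e ⊗[k] M :=
  LinearMap.rTensor M ((MvPolynomial.homogeneousComponent e).codRestrict (grading k r e)
    (MvPolynomial.homogeneousComponent_mem e))

/-- The inclusion of `(k[Y₁, …, Yᵣ])_e ⊗ₖ M` in `k[Y₁, …, Yᵣ] ⊗ₖ M`. -/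
def inclMap (r : ℕ) (M : Type u) [AddCommGroup M] [Module k M] (e : ℕ) :
    grading k r e ⊗[k] M →ₗ[k] MvPolynomial (Fin r) k ⊗[k] M :=
  LinearMap.rTensor M (grading k r e).subtype

lemma homogeneousComponent_X_mul (l : Fin r) (e : ℕ) (f : MvPolynomial (Fin r) k) :
    MvPolynomial.homogeneousComponent (e + 1) (MvPolynomial.X l * f) =
      MvPolynomial.X l * MvPolynomial.homogeneousComponent e f := by
  classical
  ext d
  rw [MvPolynomial.coeff_homogeneousComponent, MvPolynomial.coeff_X_mul',
    MvPolynomial.coeff_X_mul']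
  by_cases hl : l ∈ d.support
  · have := congrArg Finsupp.degree (tsub_add_cancel_of_le
      (Finsupp.single_le_iff.mpr (Nat.one_le_iff_ne_zero.mpr (Finsupp.mem_support_iff.mp hl))))
    rw [map_add, Finsupp.degree_single] at this
    rw [if_pos hl, if_pos hl, MvPolynomial.coeff_homogeneousComponent]
    exact if_congr (by omega) rfl rfl
  · rw [if_neg hl, if_neg hl, ite_self]

lemma thetaPoly_inclMap_componentMap (X : Fin r → M →ₗ[k] N) (e : ℕ)
    (z : MvPolynomial (Fin r) k ⊗[k] M) :
    thetaPoly X (inclMap r M e (componentMap r M e z)) =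
      inclMap r N (e + 1) (componentMap r N (e + 1) (thetaPoly X z)) := by
  induction z with
  | zero => simp only [map_zero]
  | add z z' hz hz' => simp only [map_add, hz, hz']
  | tmul f m =>
    simp [inclMap, componentMap, thetaPoly_tmul, homogeneousComponent_X_mul]

/-- A preimage can be taken homogeneous: `θ` raises degree by one, so the degree `e'` component of
any preimage maps to the degree `c + e` component of the target, which is all of it. -/
lemma exists_thetaPoly_inclMap_eq (X : Fin r → M →ₗ[k] N) {l : Fin r} {c : ℕ}
    (hc : ∀ z : MvPolynomial (Fin r) k ⊗[k] N,
      (MvPolynomial.X l ^ c : MvPolynomial (Fin r) k) • z ∈ LinearMap.range (thetaPoly X))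
    {e e' : ℕ} (he : c + e = e' + 1) (v : grading k r e ⊗[k] N) :
    ∃ w : grading k r e' ⊗[k] M, thetaPoly X (inclMap r M e' w) =
      (MvPolynomial.X l ^ c : MvPolynomial (Fin r) k) • inclMap r N e v := by
  obtain ⟨z, hz⟩ := hc (inclMap r N e v)
  refine ⟨componentMap r M e' z, ?_⟩
  rw [thetaPoly_inclMap_componentMap, hz, ← he]
  clear hz hc
  induction v with
  | zero => simp only [map_zero, smul_zero]
  | add v v' h h' => simp only [map_add, smul_add, h, h']
  | tmul f m =>
    have hf : (MvPolynomial.X l ^ c * f.1).IsHomogeneous (c + e) := by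
      simpa using ((MvPolynomial.isHomogeneous_X k l).pow c).mul f.2
    simp [inclMap, componentMap, TensorProduct.smul_tmul',
      MvPolynomial.homogeneousComponent_of_mem hf]

end Polynomials

/-! ### Morphisms between twists defined on stalks -/

section Stalkwise

variable {k : Type u} [Field k] {r : ℕ} {M N P : Type u} [AddCommGroup M] [Module k M]
  [AddCommGroup N] [Module k N] [AddCommGroup P] [Module k P]

/-- The morphism `M ⊗ₖ 𝒪(n) ⟶ N ⊗ₖ 𝒪(m)` given by linear maps on the stalks. -/
def twistHom {n m : ℤ} (φ : ∀ x : projTop k r, LocAt x ⊗[k] M →ₗ[LocAt x] LocAt x ⊗[k] N)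
    (hφ : ∀ (U : (Opens (projTop k r))ᵒᵖ) (s : twistSections M n U),
      (fun x : U.unop => φ x.1 (s.1 x)) ∈ twistSections N m U) :
    (twist M n : (projSpace k r).Modules) ⟶ twist N m :=
  SheafOfModules.Hom.mk (PresheafOfModules.homMk
    { app := fun U => AddCommGrpCat.ofHom
        { toFun := fun s : twistSections M n U => (⟨_, hφ U s⟩ : twistSections N m U)
          map_zero' := Subtype.ext (funext fun x => map_zero (φ x.1))
          map_add' := fun s t => Subtype.ext (funext fun x =>
            map_add (φ x.1) (s.1 x) (t.1 x)) }
      naturality := fun _ _ _ => rfl }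
    (fun _ a s => Subtype.ext (funext fun x => (φ x.1).map_smul (valAt x a) (s.1 x))))

lemma twistHom_congr {n m : ℤ} {φ ψ : ∀ x : projTop k r, LocAt x ⊗[k] M →ₗ[LocAt x] LocAt x ⊗[k] N}
    (h : φ = ψ) (hφ : ∀ (U : (Opens (projTop k r))ᵒᵖ) (s : twistSections M n U),
      (fun x : U.unop => φ x.1 (s.1 x)) ∈ twistSections N m U)
    (hψ : ∀ (U : (Opens (projTop k r))ᵒᵖ) (s : twistSections M n U),
      (fun x : U.unop => ψ x.1 (s.1 x)) ∈ twistSections N m U) :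
    twistHom φ hφ = twistHom ψ hψ := by
  subst h
  rfl

lemma comp_mem_twistSections {n m l : ℤ}
    {φ : ∀ x : projTop k r, LocAt x ⊗[k] M →ₗ[LocAt x] LocAt x ⊗[k] N}
    {ψ : ∀ x : projTop k r, LocAt x ⊗[k] N →ₗ[LocAt x] LocAt x ⊗[k] P}
    (hφ : ∀ (U : (Opens (projTop k r))ᵒᵖ) (s : twistSections M n U),
      (fun x : U.unop => φ x.1 (s.1 x)) ∈ twistSections N m U)
    (hψ : ∀ (U : (Opens (projTop k r))ᵒᵖ) (s : twistSections N m U),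
      (fun x : U.unop => ψ x.1 (s.1 x)) ∈ twistSections P l U)
    (U : (Opens (projTop k r))ᵒᵖ) (s : twistSections M n U) :
    (fun x : U.unop => (ψ x.1 ∘ₗ φ x.1) (s.1 x)) ∈ twistSections P l U :=
  hψ U ⟨_, hφ U s⟩

lemma twistHom_comp {n m l : ℤ}
    {φ : ∀ x : projTop k r, LocAt x ⊗[k] M →ₗ[LocAt x] LocAt x ⊗[k] N}
    {ψ : ∀ x : projTop k r, LocAt x ⊗[k] N →ₗ[LocAt x] LocAt x ⊗[k] P}
    (hφ : ∀ (U : (Opens (projTop k r))ᵒᵖ) (s : twistSections M n U),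
      (fun x : U.unop => φ x.1 (s.1 x)) ∈ twistSections N m U)
    (hψ : ∀ (U : (Opens (projTop k r))ᵒᵖ) (s : twistSections N m U),
      (fun x : U.unop => ψ x.1 (s.1 x)) ∈ twistSections P l U) :
    twistHom φ hφ ≫ twistHom ψ hψ =
      twistHom (fun x => ψ x ∘ₗ φ x) (comp_mem_twistSections hφ hψ) :=
  rfl

lemma mono_twistHom {n m : ℤ}
    {φ : ∀ x : projTop k r, LocAt x ⊗[k] M →ₗ[LocAt x] LocAt x ⊗[k] N}
    (hφ : ∀ (U : (Opens (projTop k r))ᵒᵖ) (s : twistSections M n U),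
      (fun x : U.unop => φ x.1 (s.1 x)) ∈ twistSections N m U)
    (h : ∀ x, Function.Injective (φ x)) : Mono (twistHom φ hφ) := by
  have key : ∀ U : (projSpace k r).Opens, Function.Injective ((twistHom φ hφ).app U) := by
    intro U s t hst
    refine Subtype.ext (funext fun x => h x.1 ?_)
    exact congrFun (congrArg Subtype.val hst) x
  refine ⟨fun f g w => ?_⟩
  ext U s
  apply key U
  have := congrArg (fun q => q.app U) w
  exact congr($this s)

/-- The hypothesis is local surjectivity, which characterizes epimorphisms of sheaves of abelian
groups; the forgetful functor from sheaves of modules reflects them. -/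
lemma epi_twistHom {n m : ℤ}
    {φ : ∀ x : projTop k r, LocAt x ⊗[k] M →ₗ[LocAt x] LocAt x ⊗[k] N}
    (hφ : ∀ (U : (Opens (projTop k r))ᵒᵖ) (s : twistSections M n U),
      (fun x : U.unop => φ x.1 (s.1 x)) ∈ twistSections N m U)
    (h : ∀ (U : Opens (projTop k r)) (t : twistSections N m (op U)) (x : U),
      ∃ (V : Opens (projTop k r)) (i : V ⟶ U) (_ : x.1 ∈ V) (s : twistSections M n (op V)),
        ∀ y : V, φ y.1 (s.1 y) = t.1 (i y)) : Epi (twistHom φ hφ) := by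
  have : Epi ((SheafOfModules.toSheaf _).map (twistHom φ hφ)) := by
    refine (TopCat.Sheaf.isLocallySurjective_iff_epi _).mp ?_
    rw [TopCat.Presheaf.isLocallySurjective_iff]
    intro U t x hx
    obtain ⟨V, i, hV, s, hs⟩ := h U t ⟨x, hx⟩
    exact ⟨V, leOfHom i, ⟨s, Subtype.ext (funext hs)⟩, hV⟩
  exact (SheafOfModules.toSheaf _).epi_of_epi_map this

end Stalkwise

/-! ### Functoriality of twists and `θ` between two different modules -/

section TwistMaps

variable {k : Type u} [Field k] {r : ℕ} {M N P Q : Type u} [AddCommGroup M] [Module k M]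
  [AddCommGroup N] [Module k N] [AddCommGroup P] [Module k P] [AddCommGroup Q] [Module k Q]

/-- The map `k[Y₁, …, Yᵣ] ⊗ₖ M → k[Y₁, …, Yᵣ]_x ⊗ₖ M`. -/
def locMap (M : Type u) [AddCommGroup M] [Module k M] (x : projTop k r) :
    MvPolynomial (Fin r) k ⊗[k] M →ₗ[k] LocAt x ⊗[k] M :=
  LinearMap.rTensor M (IsScalarTower.toAlgHom k (MvPolynomial (Fin r) k) (LocAt x)).toLinearMap

lemma locMap_inclMap (e : ℕ) (x : projTop k r) (v : grading k r e ⊗[k] M) :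
    locMap M x (inclMap r M e v) = numMap M e x v := by
  rw [numMap, LinearMap.rTensor_comp]
  rfl

lemma locMap_smul (x : projTop k r) (f : MvPolynomial (Fin r) k)
    (z : MvPolynomial (Fin r) k ⊗[k] M) : locMap M x (f • z) = f • locMap M x z := by
  induction z with
  | zero => simp
  | add z z' hz hz' => simp only [smul_add, map_add, hz, hz']
  | tmul g m => simp [locMap, TensorProduct.smul_tmul', Algebra.smul_def]

lemma componentMap_inclMap (e : ℕ) (v : grading k r e ⊗[k] M) :
    componentMap r M e (inclMap r M e v) = v := by
  induction v with
  | zero => simp only [map_zero]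
  | add v v' h h' => simp only [map_add, h, h']
  | tmul f m =>
    rw [inclMap, componentMap, LinearMap.rTensor_tmul, LinearMap.rTensor_tmul]
    congr 1
    exact Subtype.ext ((MvPolynomial.homogeneousComponent_of_mem f.2).trans (if_pos rfl))

/-- The operator `f ⊗ m ↦ ∑ᵢ Yᵢ f ⊗ Xᵢ m` from `k[Y₁, …, Yᵣ]_x ⊗ₖ M` to
`k[Y₁, …, Yᵣ]_x ⊗ₖ N`. -/
def thetaStalk (X : Fin r → M →ₗ[k] N) (x : projTop k r) :
    LocAt x ⊗[k] M →ₗ[LocAt x] LocAt x ⊗[k] N :=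
  ∑ i, algebraMap (MvPolynomial (Fin r) k) (LocAt x) (MvPolynomial.X i) •
    (X i).baseChange (LocAt x)

lemma thetaStalk_tmul (X : Fin r → M →ₗ[k] N) (x : projTop k r) (f : LocAt x) (m : M) :
    thetaStalk X x (f ⊗ₜ m) =
      ∑ i, (algebraMap (MvPolynomial (Fin r) k) (LocAt x) (MvPolynomial.X i) * f) ⊗ₜ X i m := by
  simp [thetaStalk, TensorProduct.smul_tmul', Algebra.smul_def]

lemma thetaStalk_locMap (X : Fin r → M →ₗ[k] N) (x : projTop k r)
    (z : MvPolynomial (Fin r) k ⊗[k] M) :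
    thetaStalk X x (locMap M x z) = locMap N x (thetaPoly X z) := by
  induction z with
  | zero => simp
  | add z z' hz hz' => simp only [map_add, hz, hz']
  | tmul f m => simp [locMap, thetaPoly_tmul, thetaStalk_tmul]

/-- Maps on stalks that come from maps on numerators preserve sections of twists. -/
lemma mem_twistSections_of_numMap {n m : ℤ} (c : ℕ) (h : n + c = m)
    (φ : ∀ x : projTop k r, LocAt x ⊗[k] M →ₗ[LocAt x] LocAt x ⊗[k] N)
    (hφ : ∀ e (v : grading k r e ⊗[k] M), ∃ w : grading k r (e + c) ⊗[k] N,
      ∀ x, numMap N (e + c) x w = φ x (numMap M e x v))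
    (U : (Opens (projTop k r))ᵒᵖ) (s : twistSections M n U) :
    (fun x : U.unop => φ x.1 (s.1 x)) ∈ twistSections N m U := by
  intro x
  obtain ⟨V, hV, i, d, e, he, g, v, w⟩ := s.2 x
  obtain ⟨z, hz⟩ := hφ e v
  refine ⟨V, hV, i, d, e + c, by push_cast; omega, g, z, fun y => ⟨(w y).1, ?_⟩⟩
  rw [hz, ← (w y).2]
  exact ((φ y.1).map_smul_of_tower g.1 (s.1 (i y))).symm

lemma baseChange_mem_twistSections (φ : M →ₗ[k] N) (n : ℤ)
    (U : (Opens (projTop k r))ᵒᵖ) (s : twistSections M n U) :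
    (fun x : U.unop => φ.baseChange (LocAt x.1) (s.1 x)) ∈ twistSections N n U := by
  refine mem_twistSections_of_numMap 0 (by simp) (fun x => φ.baseChange (LocAt x))
    (fun e v => ⟨φ.lTensor (grading k r e) v, fun x => ?_⟩) U s
  change numMap N e x _ = _
  induction v with
  | zero => simp only [map_zero]
  | add v v' h h' => simp only [map_add, h, h']
  | tmul f m => simp [numMap]

/-- The morphism `M ⊗ₖ 𝒪(n) ⟶ N ⊗ₖ 𝒪(n)` induced by a linear map `M → N`. -/
def twistMap (φ : M →ₗ[k] N) (n : ℤ) : (twist M n : (projSpace k r).Modules) ⟶ twist N n :=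
  twistHom (fun x => φ.baseChange (LocAt x)) (baseChange_mem_twistSections φ n)

lemma mono_twistMap (φ : M →ₗ[k] N) (hφ : Function.Injective φ) (n : ℤ) :
    Mono (twistMap (r := r) φ n) :=
  mono_twistHom _ fun x => Module.Flat.lTensor_preserves_injective_linearMap (M := LocAt x) φ hφ

lemma twistMap_id (n : ℤ) :
    twistMap (r := r) (LinearMap.id : M →ₗ[k] M) n = 𝟙 (twist M n) :=
  (twistHom_congr (ψ := fun _ => LinearMap.id) (funext fun _ => LinearMap.baseChange_id) _
    (fun _ s => s.2)).trans rfl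

lemma twistMap_comp (φ : M →ₗ[k] N) (ψ : N →ₗ[k] P) (n : ℤ) :
    twistMap (r := r) φ n ≫ twistMap ψ n = twistMap (ψ ∘ₗ φ) n :=
  (twistHom_comp _ _).trans
    (twistHom_congr (funext fun _ => (LinearMap.baseChange_comp ..).symm) _ _)

lemma thetaStalk_mem_twistSections (X : Fin r → M →ₗ[k] N) {n m : ℤ} (h : n + 1 = m)
    (U : (Opens (projTop k r))ᵒᵖ) (s : twistSections M n U) :
    (fun x : U.unop => thetaStalk X x.1 (s.1 x)) ∈ twistSections N m U := by
  refine mem_twistSections_of_numMap 1 h (thetaStalk X) (fun e v =>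
    ⟨componentMap r N (e + 1) (thetaPoly X (inclMap r M e v)), fun x => ?_⟩) U s
  rw [← locMap_inclMap, ← thetaPoly_inclMap_componentMap, componentMap_inclMap,
    ← thetaStalk_locMap, locMap_inclMap]

/-- The morphism `M ⊗ₖ 𝒪(n) ⟶ N ⊗ₖ 𝒪(n + 1)`, `m ⊗ f ↦ ∑ᵢ Xᵢ m ⊗ Yᵢ f`. -/
def thetaHom (X : Fin r → M →ₗ[k] N) {n m : ℤ} (h : n + 1 = m) :
    (twist M n : (projSpace k r).Modules) ⟶ twist N m :=
  twistHom (thetaStalk X) (thetaStalk_mem_twistSections X h)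

/-- Separate source and target modules are needed because `θ` has to be regarded as going from
`Rad^j(M)` to `Rad^{j+1}(M)`; this links that version to the original. -/
lemma thetaHom_eq_theta (X : Fin r → Module.End k M) {n m : ℤ} (h : n + 1 = m) :
    thetaHom X h = theta X h :=
  rfl

lemma thetaHom_naturality (X : Fin r → M →ₗ[k] N) (Y : Fin r → P →ₗ[k] Q) (φ : M →ₗ[k] P)
    (ψ : N →ₗ[k] Q) (w : ∀ l, ψ ∘ₗ X l = Y l ∘ₗ φ) {n m : ℤ} (h : n + 1 = m) :
    thetaHom X h ≫ twistMap ψ m = twistMap φ n ≫ thetaHom Y h := by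
  refine (twistHom_comp _ _).trans ((twistHom_congr (funext fun x => ?_) _ _).trans
    (twistHom_comp _ _).symm)
  ext m
  have hw : ∀ l, ψ (X l m) = Y l (φ m) := fun l => LinearMap.congr_fun (w l) m
  simp [thetaStalk_tmul, hw]

/-- `θ` is an epimorphism of sheaves if its fibres at all closed points are surjective. -/
lemma epi_thetaHom [IsAlgClosed k] [Module.Finite k N] (X : Fin r → M →ₗ[k] N)
    (hX : ∀ α : Fin r → k, α ≠ 0 → Function.Surjective (∑ l, α l • X l : M →ₗ[k] N))
    {n m : ℤ} (h : n + 1 = m) : Epi (thetaHom X h) := by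
  refine epi_twistHom _ fun U t x => ?_
  obtain ⟨V, hV, i, d, e, he, g, v, hv⟩ := t.2 x
  obtain ⟨l, hl⟩ := exists_X_notMem x.1
  obtain ⟨c, hc⟩ := exists_X_pow_smul_mem_range X hX l
  -- The extra factor `Y_l` makes the degree `c + 1 + e` of the target positive even if `c = e = 0`,
  -- so that the preimage has a natural number `c + e` as degree.
  have hc' : ∀ z : MvPolynomial (Fin r) k ⊗[k] N,
      (MvPolynomial.X l ^ (c + 1) : MvPolynomial (Fin r) k) • z ∈
        LinearMap.range (thetaPoly X) := fun z => by
    rw [pow_succ, mul_smul]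
    exact hc _
  obtain ⟨w, hw⟩ := exists_thetaPoly_inclMap_eq X hc' (e' := c + e) (by omega) v
  let f : grading k r (c + 1 + d) := ⟨MvPolynomial.X l ^ (c + 1) * g.1,
    SetLike.mul_mem_graded (A := grading k r)
      (by simpa using (MvPolynomial.isHomogeneous_X k l).pow (c + 1)) g.2⟩
  let W := V ⊓ ProjectiveSpectrum.basicOpen (grading k r) (MvPolynomial.X l)
  have hf : ∀ y : W, f.1 ∈ (primeAt y.1).primeCompl := fun y =>
    (primeAt y.1).primeCompl.mul_mem
      ((primeAt y.1).primeCompl.pow_mem (show _ ∈ (primeAt y.1).primeCompl from y.2.2) _)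
      (hv ⟨y.1, y.2.1⟩).1
  -- The local lift of `t = v / g` is `w / (Y_l^{c+1} g)`, where `θ w = Y_l^{c+1} v`.
  let s : ∀ y : W, LocAt y.1 ⊗[k] M := fun y =>
    (Localization.mk 1 ⟨f.1, hf y⟩ : LocAt y.1) • numMap M (c + e) y.1 w
  have hs : ∀ y : W, f.1 • s y = numMap M (c + e) y.1 w := fun y => by
    have h1 : f.1 • (Localization.mk 1 ⟨f.1, hf y⟩ : LocAt y.1) = 1 := by
      rw [Localization.mk_eq_mk', Algebra.smul_def]
      exact (IsLocalization.mk'_spec' (LocAt y.1) 1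
        (⟨f.1, hf y⟩ : (primeAt y.1).primeCompl)).trans (map_one _)
    rw [← smul_assoc, h1, one_smul]
  refine ⟨W, Opens.infLELeft _ _ ≫ i, ⟨hV, hl⟩, ⟨s, fun y => ⟨W, y.2, 𝟙 W, c + 1 + d, c + e,
    by push_cast; omega, f, w, fun y => ⟨hf y, hs y⟩⟩⟩, fun y => ?_⟩
  -- The denominator is a unit on each stalk, so it suffices to compare numerators.
  have hu : IsUnit (algebraMap (MvPolynomial (Fin r) k) (LocAt y.1) f.1) :=
    IsLocalization.map_units (LocAt y.1) (⟨f.1, hf y⟩ : (primeAt y.1).primeCompl)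
  refine hu.smul_left_cancel.mp ?_
  rw [algebraMap_smul, algebraMap_smul]
  refine ((thetaStalk X y.1).map_smul_of_tower f.1 (s y)).symm.trans ?_
  rw [hs, ← locMap_inclMap, thetaStalk_locMap, hw, locMap_smul, locMap_inclMap,
    ← (hv ⟨y.1, y.2.1⟩).2, ← mul_smul]
  rfl

end TwistMaps

/-! ### Powers of `θ` and the index shift -/

section ThetaPowers

variable {k : Type u} [Field k] {r : ℕ} {M N : Type u} [AddCommGroup M] [Module k M]
  [AddCommGroup N] [Module k N]

lemma thetaPow_naturality (X : Fin r → Module.End k M) (Y : Fin r → Module.End k N)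
    (φ : M →ₗ[k] N) (w : ∀ l, φ ∘ₗ X l = Y l ∘ₗ φ) (i : ℕ) (n m : ℤ) (h : n + i = m) :
    thetaPow X i n m h ≫ twistMap φ m = twistMap φ n ≫ thetaPow Y i n m h := by
  induction i generalizing n with
  | zero =>
    obtain rfl : n = m := by simpa using h
    simp [thetaPow]
  | succ i ih =>
    rw [thetaPow, thetaPow, Category.assoc, ih, ← Category.assoc, ← thetaHom_eq_theta,
      thetaHom_naturality X Y φ φ w, Category.assoc]
    rfl

lemma thetaPow_zero (X : Fin r → Module.End k M) (n : ℤ) (h : n + (0 : ℕ) = n) :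
    thetaPow X 0 n n h = 𝟙 (twist M n) :=
  rfl

lemma thetaPow_add (X : Fin r → Module.End k M) (j i : ℕ) (n l m : ℤ) (hl : n + j = l)
    (hm : l + i = m) (h : n + (j + i : ℕ) = m) :
    thetaPow X (j + i) n m h = thetaPow X j n l hl ≫ thetaPow X i l m hm := by
  induction j generalizing n with
  | zero =>
    obtain rfl : n = l := by simpa using hl
    rw [thetaPow_zero, Category.id_comp]
    congr 1
    exact Nat.zero_add i
  | succ j ih =>
    -- The exponent `j + 1 + i` is not literally a successor, so the recursion is unfolded for a
    -- general `c` equal to one.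
    have key : ∀ (c : ℕ) (hc : c = j + i + 1) (h : n + (c : ℕ) = m), thetaPow X c n m h =
        theta X rfl ≫ thetaPow X (j + i) (n + 1) m (by push_cast [hc] at h ⊢; omega) := by
      rintro c rfl h
      rfl
    rw [key _ (by omega), ih (n + 1) (by push_cast at hl; omega), thetaPow, Category.assoc]

lemma thetaPow_succ (X : Fin r → Module.End k M) (j : ℕ) (n l m : ℤ) (hl : n + j = l)
    (hm : l + 1 = m) (h : n + (j + 1 : ℕ) = m) :
    thetaPow X (j + 1) n m h = thetaPow X j n l hl ≫ theta X hm := by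
  subst hm
  rw [thetaPow_add X j 1 n l (l + 1) hl (by simp) h]
  congr 1

/-- If `θ^j` maps `M ⊗ₖ 𝒪` onto `N ⊗ₖ 𝒪` for a submodule `N` of `M`, then the
subquotients for `M` are those for `N` with the index shifted by `j`. -/
theorem nonempty_subquotientSheaf_iso (X : Fin r → Module.End k M) (Y : Fin r → Module.End k N)
    (φ : N →ₗ[k] M) (hφ : Function.Injective φ) (w : ∀ l, φ ∘ₗ Y l = X l ∘ₗ φ) (j : ℕ)
    (hq : ∀ (n m : ℤ) (h : n + j = m), ∃ q : (twist M n : (projSpace k r).Modules) ⟶ twist N m,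
      Epi q ∧ q ≫ twistMap φ m = thetaPow X j n m h) (i : ℕ) (hji : j < i) :
    Nonempty (subquotientSheaf X i ≅ subquotientSheaf Y (i - j)) := by
  have := mono_twistMap (r := r) φ hφ
  have him : ∀ c, imThetaPow X (j + c) = (Subobject.map (twistMap φ 0)).obj (imThetaPow Y c) := by
    intro c
    obtain ⟨q, hq, hqw⟩ := hq (-(j + c : ℕ)) (-c) (by push_cast; omega)
    have e : thetaPow X (j + c) (-(j + c : ℕ)) 0 (neg_add_cancel _) =
        q ≫ thetaPow Y c (-c) 0 (neg_add_cancel _) ≫ twistMap φ 0 := by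
      rw [thetaPow_naturality Y X φ w, thetaPow_add X j c _ (-c) 0 (by push_cast; omega)
        (neg_add_cancel _), ← hqw, Category.assoc]
    refine (congrArg (fun f => imageSubobject f) e).trans ?_
    rw [imageSubobject_epi_comp, imageSubobject_comp_mono_eq_map]
    rfl
  have hinf : ∀ c, (Subobject.map (twistMap φ 0)).obj (kerTheta Y ⊓ imThetaPow Y c) =
      kerTheta X ⊓ imThetaPow X (j + c) := by
    intro c
    -- The kernel of `θ_Y` contributes an extra intersection with `N ⊗ 𝒪`; it is absorbed because
    -- the image term already lies there.
    have hle : (Subobject.map (twistMap φ 0)).obj (imThetaPow Y c) ≤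
        Subobject.mk (twistMap φ 0) := by
      rw [← Subobject.map_top]
      exact (Subobject.map (twistMap φ 0)).monotone le_top
    rw [Subobject.inf_map, kerTheta, map_kernelSubobject (twistMap φ 0) (twistMap φ 1)
      (theta X (zero_add 1)) (theta Y (zero_add 1)) (thetaHom_naturality Y X φ φ w (zero_add 1)), him,
      inf_assoc, inf_eq_right.mpr hle, kerTheta]
  refine nonempty_cokernel_ofLE_iso (twistMap φ 0) _ _ ?_ ?_
  · rw [hinf, Nat.add_sub_cancel' hji.le]
  -- The numerator has index `i - 1`; the strict inequality `j < i` gives `j ≤ i - 1`, so the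
  -- truncated subtraction is harmless.
  · rw [hinf, Nat.sub_right_comm, Nat.add_sub_cancel' (Nat.le_sub_one_of_lt hji)]

end ThetaPowers

/-! ### The Jacobson radical of `kE` and its powers acting on `M` -/

section Radicals

variable (k : Type u) [Field k] {p r : ℕ} {E : Type v} [CommGroup E]
  (e : Multiplicative (Fin r → ZMod p) ≃* E)

/-- Modulo this ideal the generators of `E` become 1, hence so does every group element. -/
lemma of_sub_one_mem_span_xGen [NeZero p] (g : E) :
    MonoidAlgebra.of k E g - 1 ∈ Ideal.span (Set.range (xGen k e)) := by
  let f : E →* MonoidAlgebra k E ⧸ Ideal.span (Set.range (xGen k e)) :=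
    (Ideal.Quotient.mk _ : _ →+* _).toMonoidHom.comp (MonoidAlgebra.of k E)
  have hf : ∀ i, f (e (Multiplicative.ofAdd (Pi.single i 1))) = 1 := fun i => by
    rw [← sub_eq_zero]
    exact Ideal.Quotient.eq_zero_iff_mem.mpr (Ideal.subset_span ⟨i, rfl⟩)
  have hsingle : ∀ i (c : ZMod p), f (e (Multiplicative.ofAdd (Pi.single i c))) = 1 := fun i c => by
    have : Multiplicative.ofAdd (Pi.single i c : Fin r → ZMod p) =
        Multiplicative.ofAdd (Pi.single i 1) ^ c.val := by
      rw [← ofAdd_nsmul, ← Pi.single_smul, nsmul_one, ZMod.natCast_zmod_val]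
    rw [this, map_pow, map_pow, hf, one_pow]
  have hall : f g = 1 := by
    obtain ⟨a, rfl⟩ := e.surjective g
    rw [← ofAdd_toAdd a, ← Finset.univ_sum_single a.toAdd, ofAdd_sum, map_prod, map_prod]
    exact Finset.prod_eq_one fun i _ => hsingle i _
  rw [← Ideal.Quotient.eq_zero_iff_mem, map_sub, map_one, sub_eq_zero]
  exact hall

/-- In characteristic `p`, `(g - 1)^p = g^p - 1 = 0`, and a nilpotent element lies in every maximal
ideal. -/
lemma xGen_mem_jacobson [Fact p.Prime] [CharP k p] (l : Fin r) :
    xGen k e l ∈ Ring.jacobson (MonoidAlgebra k E) := by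
  have : CharP (MonoidAlgebra k E) p := charP_of_injective_algebraMap' k p
  have h : xGen k e l ^ p = 0 := by
    rw [xGen, sub_pow_char, ← map_pow, ← map_pow, ← ofAdd_nsmul, ← Pi.single_smul, nsmul_one,
      CharP.cast_eq_zero, Pi.single_zero, ofAdd_zero, map_one, map_one, one_pow, sub_self]
  rw [Ring.jacobson_eq_sInf_isMaximal, Ideal.mem_sInf]
  intro I hI
  exact (hI : I.IsMaximal).isPrime.mem_of_pow_mem p (by rw [h]; exact I.zero_mem)

/-- The augmentation ideal is maximal, so it contains the radical. It lies in the span because the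
quotient map by the span sends all group elements to 1 and so factors through the augmentation `ε`.
-/
lemma jacobson_eq_span_xGen [Fact p.Prime] [CharP k p] :
    Ring.jacobson (MonoidAlgebra k E) = Ideal.span (Set.range (xGen k e)) := by
  apply le_antisymm
  · let ε : MonoidAlgebra k E →ₐ[k] k := MonoidAlgebra.lift k k E 1
    have hε : (RingHom.ker ε).IsMaximal :=
      RingHom.ker_isMaximal_of_surjective ε fun c =>
        ⟨algebraMap k (MonoidAlgebra k E) c, ε.commutes c⟩
    have hmk : Ideal.Quotient.mkₐ k (Ideal.span (Set.range (xGen k e))) =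
        (Algebra.ofId k _).comp ε := by
      refine MonoidAlgebra.algHom_ext (fun g => ?_) (Subsingleton.elim _ _)
      have := Ideal.Quotient.eq_zero_iff_mem.mpr (of_sub_one_mem_span_xGen k e g)
      rw [map_sub, sub_eq_zero, map_one] at this
      refine Eq.trans this ?_
      simp [ε]
    intro x hx
    have hx' : x ∈ RingHom.ker ε := Ring.jacobson_le_of_isMaximal _ hx
    rw [RingHom.mem_ker] at hx'
    have := AlgHom.congr_fun hmk x
    rw [AlgHom.comp_apply, hx', map_zero] at this
    exact Ideal.Quotient.eq_zero_iff_mem.mp this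
  · rw [Ideal.span_le]
    rintro _ ⟨l, rfl⟩
    exact xGen_mem_jacobson k e l

variable (M : Type u) [AddCommGroup M] [Module (MonoidAlgebra k E) M]

lemma xGen_smul_mem_radPow [Fact p.Prime] [CharP k p] (l : Fin r) {j : ℕ} {m : M}
    (hm : m ∈ radPow k E M j) : xGen k e l • m ∈ radPow k E M (j + 1) := by
  rw [radPow, pow_succ', Submodule.mul_smul]
  exact Submodule.smul_mem_smul (xGen_mem_jacobson k e l) hm

variable {M} in
/-- For modules with equal images, `X_α Rad^j(M) = Rad^{j+1}(M)` for all `α ≠ 0`. -/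
lemma HasEqualImages.exists_xAlpha_smul_eq [Fact p.Prime] [CharP k p] (hM : HasEqualImages k e M)
    {α : Fin r → k} (hα : α ≠ 0) {j : ℕ} {m : M} (hm : m ∈ radPow k E M (j + 1)) :
    ∃ n ∈ radPow k E M j, xAlpha k e α • n = m := by
  let f : M →ₗ[MonoidAlgebra k E] M := LinearMap.lsmul (MonoidAlgebra k E) M (xAlpha k e α)
  have h1 : Ring.jacobson (MonoidAlgebra k E) • (⊤ : Submodule (MonoidAlgebra k E) M) ≤
      LinearMap.range f := by
    rw [jacobson_eq_span_xGen k e, Submodule.smul_le]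
    intro x hx n _
    induction hx using Submodule.span_induction with
    | mem x hx =>
      obtain ⟨l, rfl⟩ := hx
      have hl : xAlpha k e (Pi.single l 1) = xGen k e l := by
        rw [xAlpha, Finset.sum_eq_single l (fun i _ hi => by rw [Pi.single_eq_of_ne hi, zero_smul])
          (fun h => absurd (Finset.mem_univ l) h), Pi.single_eq_same, one_smul]
      have : xGen k e l • n ∈ Set.range fun m : M => xAlpha k e (Pi.single l 1) • m :=
        ⟨n, by rw [hl]⟩
      -- Equal images enters here: `X_l` is `X_β` for the unit vector `β`, so `X_l M = X_α M`.
      rw [hM _ α (by simp) hα] at this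
      exact this
    | zero => rw [zero_smul]; exact zero_mem _
    | add x y _ _ hx hy => rw [add_smul]; exact add_mem hx hy
    | smul a x _ hx => rw [smul_assoc]; exact Submodule.smul_mem _ a hx
  -- `J^{j+1} M = J^j (J M)` lies in `J^j (X_α M)`, which is `X_α (J^j M)` since multiplication by
  -- `X_α` is `kE`-linear.
  rw [radPow, pow_succ, Submodule.mul_smul] at hm
  have h2 := Submodule.smul_mono le_rfl h1 hm
  rw [LinearMap.range_eq_map, ← Submodule.map_smul''] at h2
  exact h2

end Radicals

/-! ### Factoring `θ^j` through the radical -/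

section RadicalSheaves

variable (k : Type u) [Field k] {p r : ℕ} {E : Type v} [CommGroup E]
  (e : Multiplicative (Fin r → ZMod p) ≃* E)
  (M : Type u) [AddCommGroup M] [Module k M] [Module (MonoidAlgebra k E) M]
  [IsScalarTower k (MonoidAlgebra k E) M]

/-- The inclusion `Rad^j(M) → M` as a `k`-linear map. -/
def radIncl (j : ℕ) : radPow k E M j →ₗ[k] M :=
  (radPow k E M j).subtype.restrictScalars k

/-- Multiplication by `X_l`, as a map `Rad^j(M) → Rad^{j+1}(M)`. -/
def radMul [Fact p.Prime] [CharP k p] (j : ℕ) (l : Fin r) :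
    radPow k E M j →ₗ[k] radPow k E M (j + 1) where
  toFun m := ⟨xGen k e l • m.1, xGen_smul_mem_radPow k e M l m.2⟩
  map_add' _ _ := Subtype.ext (smul_add _ _ _)
  map_smul' c m := Subtype.ext (smul_algebra_smul_comm c (xGen k e l) m.1)

variable {M}

lemma HasEqualImages.radMul_surjective [Fact p.Prime] [CharP k p] (hM : HasEqualImages k e M)
    (j : ℕ) (α : Fin r → k) (hα : α ≠ 0) :
    Function.Surjective
      (∑ l, α l • radMul k e M j l : radPow k E M j →ₗ[k] radPow k E M (j + 1)) := by
  rintro ⟨m, hm⟩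
  obtain ⟨n, hn, rfl⟩ := hM.exists_xAlpha_smul_eq k e hα hm
  refine ⟨⟨n, hn⟩, Subtype.ext ?_⟩
  change radIncl k M (j + 1) _ = _
  simp only [LinearMap.sum_apply, map_sum, xAlpha, Finset.sum_smul]
  refine Finset.sum_congr rfl fun l _ => ?_
  rw [LinearMap.smul_apply, map_smul, smul_assoc]
  rfl

/-- For modules with equal images, `θ^j` maps `M ⊗ₖ 𝒪(n)` onto `Rad^j(M) ⊗ₖ 𝒪(n + j)`. -/
lemma HasEqualImages.exists_epi_comp_eq_thetaPow [IsAlgClosed k] [Fact p.Prime] [CharP k p]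
    [Module.Finite k M] (hM : HasEqualImages k e M) (j : ℕ) (n m : ℤ) (h : n + j = m) :
    ∃ q : (twist M n : (projSpace k r).Modules) ⟶ twist (radPow k E M j) m,
      Epi q ∧ q ≫ twistMap (radIncl k M j) m =
        thetaPow (fun l => (Algebra.lsmul k k M (xGen k e l) : Module.End k M)) j n m h := by
  induction j generalizing m with
  | zero =>
    obtain rfl : n = m := by simpa using h
    -- `Rad^0(M)` is all of `M` but a different type, so the epimorphism for `j = 0` is induced by
    -- the evident isomorphism.
    have htop : ∀ x : M, x ∈ radPow k E M 0 := fun x => by simp [radPow]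
    let φ : M →ₗ[k] radPow k E M 0 :=
      { toFun x := ⟨x, htop x⟩
        map_add' _ _ := rfl
        map_smul' _ _ := rfl }
    have h1 : radIncl k M 0 ∘ₗ φ = LinearMap.id := rfl
    have h2 : φ ∘ₗ radIncl k M 0 = LinearMap.id := rfl
    refine ⟨twistMap φ n, ?_, ?_⟩
    · refine epi_of_epi_fac (f := twistMap (radIncl k M 0) n) (h := 𝟙 _) ?_
      rw [twistMap_comp, h2, twistMap_id]
    · rw [twistMap_comp, h1, twistMap_id, thetaPow_zero]
  | succ j ih =>
    obtain ⟨q, hq, hqw⟩ := ih (n + j) rfl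
    have hm : n + j + 1 = m := by push_cast at h; omega
    have : Module.Finite k (radPow k E M (j + 1)) :=
      Module.Finite.of_injective (radIncl k M (j + 1)) Subtype.val_injective
    -- One further factor of `θ` carries `Rad^j(M)` onto `Rad^{j+1}(M)`.
    have := epi_thetaHom (radMul k e M j) (hM.radMul_surjective k e j) hm
    refine ⟨q ≫ thetaHom (radMul k e M j) hm, epi_comp _ _, ?_⟩
    rw [thetaPow_succ _ j n (n + j) m rfl hm, ← hqw, Category.assoc, Category.assoc,
      ← thetaHom_eq_theta, thetaHom_naturality (radMul k e M j)
        (fun l => (Algebra.lsmul k k M (xGen k e l) : Module.End k M)) (radIncl k M j)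
        (radIncl k M (j + 1)) (fun l => rfl)]

end RadicalSheaves

end

end EqualImages

theorem theorem5p4 {k : Type u} [Field k] [IsAlgClosed k] {p : ℕ} [Fact p.Prime] [CharP k p]
    {r : ℕ} {E : Type v} [CommGroup E] (e : Multiplicative (Fin r → ZMod p) ≃* E)
    (M : Type u) [AddCommGroup M] [Module k M] [Module (MonoidAlgebra k E) M]
    [IsScalarTower k (MonoidAlgebra k E) M] [Module.Finite k M]
    (hM : EqualImages.HasEqualImages k e M) (i j : ℕ) (hji : j < i) (hip : i ≤ p) :
    Nonempty (EqualImages.sheafF k e M i ≅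
      EqualImages.sheafF k e (EqualImages.radPow k E M j) (i - j)) := by
  have hw : ∀ l, EqualImages.radIncl k M j ∘ₗ
      Algebra.lsmul k k (EqualImages.radPow k E M j) (EqualImages.xGen k e l) =
        Algebra.lsmul k k M (EqualImages.xGen k e l) ∘ₗ EqualImages.radIncl k M j :=
    fun l => rfl
  unfold EqualImages.sheafF
  exact EqualImages.nonempty_subquotientSheaf_iso
    (fun l => (Algebra.lsmul k k M (EqualImages.xGen k e l) : Module.End k M))
    (fun l => (Algebra.lsmul k k (EqualImages.radPow k E M j) (EqualImages.xGen k e l) :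
      Module.End k (EqualImages.radPow k E M j)))
    (EqualImages.radIncl k M j) Subtype.val_injective hw j
    (hM.exists_epi_comp_eq_thetaPow k e j) i hji
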